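/- Call a topological space $X$ a P-space if every countable intersection of open sets of $X$ is open. Let $X^{\alpha}$ denote the $\alpha$-th Cantor-Bendixson derivative of $X$, and call $X$ scattered if $X^{\alpha}=\emptyset$ for some ordinal $\alpha$; in that case the height $\mathrm{ht}(X)$ is the least such $\alpha$, the levels of $X$ are $I_{\alpha}(X)=X^{\alpha}\setminus X^{\alpha+1}$ for $\alpha<\mathrm{ht}(X)$, the level $\rho(x)$ of a point $x$ is the unique $\alpha$ with $x\in I_{\alpha}(X)$, and the width of $X$ is the cardinal $\mathrm{wd}(X)=\sup\{|I_{\alpha}(X)|:\alpha<\mathrm{ht}(X)\}$. A cone on $x\in X$ is a neighbourhood $U$ of $x$ such that $x$ is the only point of $U$ of level $\geq\rho(x)$. An LLSP space is a scattered Hausdorff P-space that is locally Lindelöf (every point has a Lindelöf neighbourhood). For an uncountable cardinal $\kappa$ and an ordinal $\alpha\neq 0$, a $(\kappa,\alpha)$-LLSP space is an LLSP space of width $\kappa$ and height $\alpha$. An LLSP space $X$ is good if for every ordinal $\alpha<\mathrm{ht}(X)$ and every family $\{U_n:n\in\omega\}$ of Lindelöf clopen sets each of which is a cone on some point of $X$,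 the set $I_{\alpha}(X)\setminus\bigcup_{n\in\omega}U_n$ is uncountable. Corollary 3.4. For every ordinal $\alpha$ with $0<\alpha<\omega_3$ there is a good $(\omega_1,\alpha)$-LLSP space. -/

import Mathlib

open scoped Topology Ordinal Cardinal

universe u

namespace LLSP

/-- A P-space: the intersection of every countable family of open sets is open. -/
def IsPSpace (X : Type u) [TopologicalSpace X] : Prop :=
  ∀ U : ℕ → Set X, (∀ n, IsOpen (U n)) → IsOpen (⋂ n, U n)

/-- Locally Lindelöf: every point has a Lindelöf neighbourhood. (In a Hausdorff P-space every
point then has a neighbourhood basis of Lindelöf sets.) -/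
def IsLocallyLindelof (X : Type u) [TopologicalSpace X] : Prop :=
  ∀ x : X, ∃ K ∈ 𝓝 x, IsLindelof K

/-- The `α`-th Cantor-Bendixson derivative of the whole space: `X` for `α = 0`, the set of
accumulation points of the previous stage at successors, the intersection of the earlier stages
at limits. -/
def cbDerivative (X : Type u) [TopologicalSpace X] (α : Ordinal.{u}) : Set X :=
  CantorBendixson.iteratedDerivedSet Set.univ α

/-- A space is scattered if some Cantor-Bendixson derivative is empty. -/
def IsScattered (X : Type u) [TopologicalSpace X] : Prop :=
  ∃ α : Ordinal.{u}, cbDerivative X α = ∅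

/-- The height of a scattered space: the least `α` whose Cantor-Bendixson derivative is empty. -/
noncomputable def height (X : Type u) [TopologicalSpace X] : Ordinal.{u} :=
  sInf {α | cbDerivative X α = ∅}

/-- The `α`-th Cantor-Bendixson level `I_α(X)`. -/
def level (X : Type u) [TopologicalSpace X] (α : Ordinal.{u}) : Set X :=
  cbDerivative X α \ cbDerivative X (α + 1)

/-- The level `ρ(x)` of a point `x` of a scattered space: the (unique) `α` with `x ∈ I_α(X)`. -/
noncomputable def rank {X : Type u} [TopologicalSpace X] (x : X) : Ordinal.{u} :=
  sInf {α | x ∈ level X α}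

/-- The width of a scattered space: the supremum of the cardinalities of the levels below the
height. -/
noncomputable def width (X : Type u) [TopologicalSpace X] : Cardinal.{u} :=
  ⨆ α : Set.Iio (height X), #(level X α)

/-- The supremum in `width` is a genuine one: the family is bounded by the size of the space. -/
theorem bddAbove_level (X : Type u) [TopologicalSpace X] :
    BddAbove (Set.range fun α : Set.Iio (height X) => #(level X (α : Ordinal.{u}))) :=
  ⟨#X, by rintro _ ⟨α, rfl⟩; exact Cardinal.mk_set_le _⟩

/-- `U` is a cone on `x`: a neighbourhood of `x` in which `x` is the only point of
level `≥ ρ(x)`. -/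
def IsConeOn {X : Type u} [TopologicalSpace X] (x : X) (U : Set X) : Prop :=
  U ∈ 𝓝 x ∧ ∀ y ∈ U, rank x ≤ rank y → y = x

/-- An LLSP space: a locally Lindelöf, scattered, Hausdorff P-space. -/
structure IsLLSPSpace (X : Type u) [TopologicalSpace X] : Prop where
  locallyLindelof : IsLocallyLindelof X
  scattered : IsScattered X
  hausdorff : T2Space X
  pSpace : IsPSpace X

/-- An LLSP space is good if no level is covered, up to countably many points, by countably many
Lindelöf clopen cones. -/
def IsGood (X : Type u) [TopologicalSpace X] : Prop :=
  ∀ α < height X, ∀ U : ℕ → Set X,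
    (∀ n, IsLindelof (U n) ∧ IsClopen (U n) ∧ ∃ x, IsConeOn x (U n)) →
      ¬ (level X α \ ⋃ n, U n).Countable

/-- A `(κ, α)`-LLSP space: an LLSP space of width `κ` and height `α`
(considered for `κ` uncountable and `α ≠ 0`). -/
structure IsLLSPSpaceOf (κ : Cardinal.{u}) (α : Ordinal.{u}) (X : Type u)
    [TopologicalSpace X] : Prop extends IsLLSPSpace X where
  height_eq : height X = α
  width_eq : width X = κ

end LLSP

/-! Induction on the height, with goodness strengthened: no Lindelöf set covers a level up to
countably many points. Such a space of height `β` has a one-point Lindelöfication of height `β + 1`,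
because the complement of a Lindelöf set meets every level (`Lindelofication.isRankedSpace`). It
remains to build height `α` from Lindelöf spaces of heights `β + 1`, `β < α`.

As `α < ω₃` has cofinality at most `ω₂`, it is cut into intervals indexed by a well-order `V` whose
proper initial segments have size at most `ℵ₁`. A skeleton on `V × ω₁` is built level by level.
Below level `ν` there are at most `ℵ₁` cones; made disjoint along an indexing by `ω₁` they become
clopen pieces, as countable unions of clopen sets are clopen in a P-space. Each new point receives
uncountably many pieces, and its neighbourhoods contain all but countably many of them.

Each new point must accumulate every lower level, while cones must stay small. Small means having a
nonstationary trace on every level; pressing down secures both demands for `ℵ₁` levels at once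
(`exists_selector`). A Lindelöf set lies in countably many cones, so its traces are nonstationary
too, which is goodness. Finally each skeleton point at level `ν` is blown up to a Lindelöf space
filling the `ν`-th interval of ranks (`Blowup.isRankedSpace`). -/

namespace LLSP

/-! ### Ranked spaces and their Cantor-Bendixson levels -/

/-- A Hausdorff P-space with a base of clopen Lindelöf sets, together with a function `ρ` onto
the ordinals below `α` which turns out to be its Cantor-Bendixson rank, with levels of size at
most `ℵ₁`. -/
structure IsRankedSpace (X : Type u) [TopologicalSpace X] (ρ : X → Ordinal.{u})
    (α : Ordinal.{u}) : Prop where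
  t2 : T2Space X
  pSpace : IsPSpace X
  basis : ∀ (x : X) (O : Set X), IsOpen O → x ∈ O →
    ∃ A, IsClopen A ∧ IsLindelof A ∧ x ∈ A ∧ A ⊆ O
  cone : ∀ x : X, ∃ A ∈ 𝓝 x, ∀ y ∈ A, y ≠ x → ρ y < ρ x
  meets : ∀ x : X, ∀ A ∈ 𝓝 x, ∀ γ < ρ x, ∃ y ∈ A, ρ y = γ
  rank_lt : ∀ x, ρ x < α
  exists_rank : ∀ γ < α, ∃ x, ρ x = γ
  card_le : ∀ γ, #{x | ρ x = γ} ≤ ℵ_ 1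

namespace IsRankedSpace

variable {X : Type u} [TopologicalSpace X] {ρ : X → Ordinal.{u}} {α : Ordinal.{u}}

/-- `cone` keeps points of rank `γ` from accumulating the `γ`-th derivative, and `meets` makes
points of larger rank accumulate it. -/
theorem cbDerivative_eq (h : IsRankedSpace X ρ α) (γ : Ordinal.{u}) :
    cbDerivative X γ = {x | γ ≤ ρ x} := by
  unfold cbDerivative
  induction γ using Ordinal.limitRecOn with
  | zero => simp
  | add_one γ ih =>
    rw [CantorBendixson.iteratedDerivedSet_succ, ih]
    ext x
    change AccPt x _ ∧ _ ↔ _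
    simp only [Set.mem_ofPred_eq, accPt_iff_nhds, Order.add_one_le_iff]
    constructor
    · rintro ⟨h1, h2⟩
      obtain ⟨A, hA, hA'⟩ := h.cone x
      obtain ⟨y, ⟨hy, hy'⟩, hne⟩ := h1 A hA
      exact lt_of_le_of_lt hy' (hA' y hy hne)
    · intro hx
      refine ⟨fun A hA => ?_, hx.le⟩
      obtain ⟨y, hy, rfl⟩ := h.meets x A hA γ hx
      exact ⟨y, ⟨hy, Set.mem_ofPred.2 le_rfl⟩, fun e => by subst e; exact lt_irrefl _ hx⟩
  | limit γ hγ ih =>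
    rw [CantorBendixson.iteratedDerivedSet_limit hγ]
    ext x
    simp only [Set.mem_iInter, Set.mem_ofPred_eq]
    constructor
    · intro hx
      rw [hγ.le_iff_forall_le]
      intro β hβ
      have := hx ⟨β, hβ⟩
      rw [ih β hβ] at this
      exact this
    · rintro hx ⟨β, hβ⟩
      rw [ih β hβ]
      exact (le_of_lt hβ).trans hx

theorem level_eq (h : IsRankedSpace X ρ α) (γ : Ordinal.{u}) : level X γ = {x | ρ x = γ} := by
  ext x
  simp only [level, h.cbDerivative_eq, Set.mem_sdiff, Set.mem_ofPred_eq, Order.add_one_le_iff,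
    not_lt]
  exact ⟨fun h => le_antisymm h.2 h.1, fun h => ⟨h.ge, h.le⟩⟩

theorem cbDerivative_eq_empty_iff (h : IsRankedSpace X ρ α) (γ : Ordinal.{u}) :
    cbDerivative X γ = ∅ ↔ α ≤ γ := by
  rw [h.cbDerivative_eq, Set.eq_empty_iff_forall_notMem]
  constructor
  · intro hγ
    by_contra! hlt
    obtain ⟨x, rfl⟩ := h.exists_rank γ hlt
    exact hγ x (Set.mem_ofPred.2 le_rfl)
  · intro hγ x hx
    exact absurd (h.rank_lt x) (not_lt.2 (hγ.trans hx))

theorem height_eq (h : IsRankedSpace X ρ α) : height X = α := by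
  have : {γ | cbDerivative X γ = ∅} = Set.Ici α := by
    ext γ; exact h.cbDerivative_eq_empty_iff γ
  rw [height, this, csInf_Ici]

/-- In a good ranked space no level is covered, up to countably many points, by a Lindelöf set. -/
theorem isLLSPSpaceOf (h : IsRankedSpace X ρ α) (hα : α ≠ 0)
    (hgood : ∀ K : Set X, IsLindelof K → ∀ γ < α, ¬ ({x | ρ x = γ} \ K).Countable) :
    IsLLSPSpaceOf (ℵ_ 1) α X ∧ IsGood X := by
  refine ⟨⟨⟨fun x => ?_, ⟨α, (h.cbDerivative_eq_empty_iff α).2 le_rfl⟩, h.t2, h.pSpace⟩,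
    h.height_eq, ?_⟩, ?_⟩
  · obtain ⟨A, hA, hL, hx, -⟩ := h.basis x Set.univ isOpen_univ trivial
    exact ⟨A, hA.isOpen.mem_nhds hx, hL⟩
  · have hcard : ∀ γ : Set.Iio (height X), #(level X γ) = ℵ_ 1 := by
      rintro ⟨γ, hγ⟩
      rw [h.height_eq] at hγ
      rw [h.level_eq]
      refine le_antisymm (h.card_le γ) ?_
      have := hgood ∅ isLindelof_empty γ hγ
      rw [Set.sdiff_empty] at this
      rw [← Cardinal.succ_aleph0, Order.succ_le_iff]
      by_contra! hle
      exact this (Cardinal.le_aleph0_iff_set_countable.1 hle)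
    have : Nonempty (Set.Iio (height X)) := by
      rw [h.height_eq]; exact ⟨⟨0, pos_iff_ne_zero.2 hα⟩⟩
    rw [width, funext hcard, ciSup_const]
  · intro γ hγ U hU
    rw [h.height_eq] at hγ
    rw [h.level_eq]
    exact hgood _ (isLindelof_iUnion fun n => (hU n).1) γ hγ

end IsRankedSpace

/-! ### Nonstationary subsets of `ω₁` and pressing down -/

/-- A well-order of type `ω₁`. -/
class IsOmegaOne (W : Type u) [LinearOrder W] : Prop where
  wf : WellFoundedLT W
  countable_Iic : ∀ w : W, (Set.Iic w).Countable
  card_eq : #W = ℵ_ 1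

/-- `δ` is closed under `F`. -/
def IsClosedPt {W : Type u} [LinearOrder W] (F : W → W) (δ : W) : Prop :=
  ∀ γ < δ, F γ < δ

/-- The nonstationary sets: those which miss all closure points, except possibly the least
element, of some function. -/
def IsNonstationary {W : Type u} [LinearOrder W] (A : Set W) : Prop :=
  ∃ F : W → W, ∀ δ ∈ A, IsClosedPt F δ → IsBot δ

section

variable {W : Type u} [LinearOrder W] [hW : IsOmegaOne W]

theorem IsOmegaOne.uncountable : ¬ Countable W := by
  rw [← Cardinal.mk_le_aleph0_iff, IsOmegaOne.card_eq, not_le]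
  exact Cardinal.aleph0_lt_aleph_one

theorem IsOmegaOne.nonempty : Nonempty W := by
  by_contra h
  rw [not_nonempty_iff] at h
  exact IsOmegaOne.uncountable (W := W) inferInstance

theorem exists_forall_lt_of_countable {s : Set W} (hs : s.Countable) : ∃ w, ∀ x ∈ s, x < w := by
  by_contra! h
  refine IsOmegaOne.uncountable (W := W) (Set.countable_univ_iff.1 ?_)
  refine (hs.biUnion fun x _ => hW.countable_Iic x).mono fun w _ => ?_
  obtain ⟨x, hx, hwx⟩ := h w
  exact Set.mem_biUnion hx hwx

theorem exists_forall_lt {ι : Sort*} [Countable ι] (f : ι → W) : ∃ w, ∀ i, f i < w := by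
  obtain ⟨w, hw⟩ := exists_forall_lt_of_countable (Set.countable_range f)
  exact ⟨w, fun i => hw _ ⟨i, rfl⟩⟩

theorem not_countable_of_unbounded {s : Set W} (hs : ∀ w, ∃ x ∈ s, w ≤ x) : ¬ s.Countable := by
  intro h
  obtain ⟨w, hw⟩ := exists_forall_lt_of_countable h
  obtain ⟨x, hx, hwx⟩ := hs w
  exact absurd (hw x hx) (not_lt.2 hwx)

theorem unbounded_of_not_countable {s : Set W} (hs : ¬ s.Countable) (w : W) :
    ∃ x ∈ s, w < x := by
  by_contra! h
  exact hs ((hW.countable_Iic w).mono h)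

theorem exists_closedPt_gt (F : W → W) (w : W) : ∃ δ, w < δ ∧ IsClosedPt F δ := by
  have := hW.wf
  have hstep : ∀ x : W, ∃ y, x < y ∧ ∀ γ ≤ x, F γ < y := by
    intro x
    obtain ⟨y, hy⟩ := exists_forall_lt_of_countable (((hW.countable_Iic x).image F).insert x)
    exact ⟨y, hy x (Set.mem_insert _ _),
      fun γ hγ => hy _ (Set.mem_insert_of_mem _ ⟨γ, hγ, rfl⟩)⟩
  choose g hg hg' using hstep
  let s : ℕ → W := fun n => g^[n] w
  have hs : ∀ n, s (n + 1) = g (s n) := fun n => Function.iterate_succ_apply' g n w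
  have hne : {δ | ∀ n, s n < δ}.Nonempty := exists_forall_lt s
  have wf : WellFounded ((· < ·) : W → W → Prop) := wellFounded_lt
  -- The least strict upper bound of the iterates of `g` is closed under `F`.
  refine ⟨wf.min _ hne, wf.min_mem _ hne 0, fun γ hγ => ?_⟩
  have : ¬ ∀ n, s n < γ := fun h => wf.not_lt_min {δ | ∀ n, s n < δ} h hγ
  push Not at this
  obtain ⟨n, hn⟩ := this
  calc F γ < s (n + 1) := by rw [hs]; exact hg' _ _ hn
    _ < _ := wf.min_mem _ hne (n + 1)

omit hW in
theorem IsNonstationary.mono {A B : Set W} (hB : IsNonstationary B) (h : A ⊆ B) :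
    IsNonstationary A := by
  obtain ⟨F, hF⟩ := hB
  exact ⟨F, fun δ hδ => hF δ (h hδ)⟩

omit hW in
theorem isNonstationary_of_forall_le {A : Set W} (w : W) (h : ∀ x ∈ A, x ≤ w) :
    IsNonstationary A := by
  -- A closure point of this constant function is either least or above `w`.
  refine ⟨fun _ => w, fun δ hδ hc γ => ?_⟩
  by_contra! hlt
  exact absurd (hc γ hlt) (not_lt.2 (h δ hδ))

theorem IsNonstationary.iUnion {ι : Type*} [Countable ι] {A : ι → Set W}
    (h : ∀ i, IsNonstationary (A i)) : IsNonstationary (⋃ i, A i) := by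
  choose F hF using h
  choose G hG using fun γ => exists_forall_lt fun i => F i γ
  refine ⟨G, fun δ hδ hc => ?_⟩
  obtain ⟨i, hi⟩ := Set.mem_iUnion.1 hδ
  exact hF i δ hi fun γ hγ => (hG γ i).trans (hc γ hγ)

theorem IsNonstationary.biUnion {ι : Type*} {s : Set ι} (hs : s.Countable) {A : ι → Set W}
    (h : ∀ i ∈ s, IsNonstationary (A i)) : IsNonstationary (⋃ i ∈ s, A i) := by
  have := hs.to_subtype
  rw [Set.biUnion_eq_iUnion]
  exact IsNonstationary.iUnion fun i => h i i.2

/-- Closure points of the witnessing function are unbounded, and those that are not least avoid `A`.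
-/
theorem IsNonstationary.not_countable_compl {A : Set W} (h : IsNonstationary A) :
    ¬ Aᶜ.Countable := by
  obtain ⟨F, hF⟩ := h
  refine not_countable_of_unbounded fun w => ?_
  obtain ⟨δ, hwδ, hδ⟩ := exists_closedPt_gt F w
  exact ⟨δ, fun h => absurd hwδ (not_lt.2 (hF δ h hδ w)), hwδ.le⟩

/-- An unbounded set splits into `ℵ₁` many unbounded pieces. -/
theorem exists_unbounded_fibers {T : Type u} (hT : #T ≤ ℵ_ 1) [Nonempty T] {S : Set W}
    (hS : ∀ w, ∃ x ∈ S, w ≤ x) : ∃ p : W → T, ∀ t w, ∃ δ ∈ S, w < δ ∧ p δ = t := by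
  have hScard : #S = ℵ_ 1 := by
    refine le_antisymm ((Cardinal.mk_set_le S).trans hW.card_eq.le) ?_
    rw [← Cardinal.succ_aleph0, Order.succ_le_iff]
    by_contra! hle
    exact not_countable_of_unbounded hS (Cardinal.le_aleph0_iff_set_countable.1 hle)
  have : #S = #(T × W) := by
    rw [hScard, Cardinal.mk_prod, Cardinal.lift_id, Cardinal.lift_id, hW.card_eq,
      Cardinal.mul_eq_right (Cardinal.aleph0_le_aleph 1) hT (Cardinal.mk_ne_zero T)]
  obtain ⟨e⟩ := Cardinal.eq.1 this
  classical
  refine ⟨fun w => if h : w ∈ S then (e ⟨w, h⟩).1 else Classical.arbitrary T, fun t w => ?_⟩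
  have hinj : Function.Injective fun w' : W => ((e.symm (t, w') : S) : W) :=
    fun a b h => (Prod.ext_iff.1 (e.symm.injective (Subtype.ext h))).2
  have hunc : ¬ (Set.range fun w' : W => ((e.symm (t, w') : S) : W)).Countable := by
    intro hc
    have := hc.to_subtype
    exact IsOmegaOne.uncountable (W := W)
      ((Equiv.ofInjective _ hinj).injective.countable)
  obtain ⟨_, ⟨w', rfl⟩, hlt⟩ := unbounded_of_not_countable hunc w
  refine ⟨_, (e.symm (t, w')).2, hlt, ?_⟩
  simp

/-- Pressing down: a function with nonstationary fibres is regressive on a nonstationary set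
only. Hence the values of `ℵ₁` many such functions can be partitioned so that each piece is hit
often by every function, but only on a nonstationary set. -/
theorem exists_selector {ι T : Type u} (hT : #T ≤ ℵ_ 1) [Nonempty T] (hι : #ι ≤ ℵ_ 1)
    (k : ι → W → W) (hk : ∀ a i, IsNonstationary {η | k a η = i}) :
    ∃ q : W → Option T, (∀ a, IsNonstationary {η | q (k a η) ≠ none}) ∧
      ∀ a t ε, ∃ η, ε ≤ k a η ∧ q (k a η) = some t := by
  classical
  have := hW.wf
  have wf : WellFounded ((· < ·) : W → W → Prop) := wellFounded_lt
  have : Nonempty W := IsOmegaOne.nonempty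
  obtain ⟨c⟩ : Nonempty (ι ↪ W) := by
    rw [← hW.card_eq] at hι; exact hι
  choose f hf using hk
  -- a function dominating everything in sight
  have hF : ∀ γ : W, ∃ w, (∀ a, c a ≤ γ → ∀ γ' ≤ γ, k a γ' < w) ∧
      (∀ a, c a ≤ γ → ∀ i ≤ γ, ∀ γ' ≤ γ, f a i γ' < w) := by
    intro γ
    have hc1 := hW.countable_Iic γ
    have hcι : {a | c a ≤ γ}.Countable := hc1.preimage c.injective
    have h1 : (⋃ a ∈ {a | c a ≤ γ}, (k a '' Set.Iic γ)).Countable :=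
      hcι.biUnion fun a _ => hc1.image _
    have h2 : (⋃ a ∈ {a | c a ≤ γ}, ⋃ i ∈ Set.Iic γ, (f a i '' Set.Iic γ)).Countable :=
      hcι.biUnion fun a _ => hc1.biUnion fun i _ => hc1.image _
    obtain ⟨w, hw⟩ := exists_forall_lt_of_countable (h1.union h2)
    refine ⟨w, fun a ha γ' hγ' => hw _ (Or.inl ?_),
      fun a ha i hi γ' hγ' => hw _ (Or.inr ?_)⟩
    · exact Set.mem_biUnion ha ⟨γ', hγ', rfl⟩
    · exact Set.mem_biUnion ha (Set.mem_biUnion hi ⟨γ', hγ', rfl⟩)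
  choose F hF2 hF3 using hF
  have hk_lt : ∀ δ, IsClosedPt F δ → ∀ a, c a < δ → ∀ η < δ, k a η < δ := by
    intro δ hδ a ha η hη
    exact (hF2 (max (c a) η) a (le_max_left _ _) η (le_max_right _ _)).trans
      (hδ _ (max_lt ha hη))
  -- Pressing down: if `i = k a δ < δ`, then `δ` is closed under the witness `f a i` for the fibre
  -- containing it, hence least, against `c a < δ`.
  have hk_ge : ∀ δ, IsClosedPt F δ → ∀ a, c a < δ → δ ≤ k a δ := by
    intro δ hδ a ha
    by_contra! hlt
    refine absurd ha (not_lt.2 (hf a (k a δ) δ rfl (fun γ hγ => ?_) (c a)))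
    exact (hF3 (max (max (c a) (k a δ)) γ) a ((le_max_left _ _).trans (le_max_left _ _)) _
      ((le_max_right _ _).trans (le_max_left _ _)) γ (le_max_right _ _)).trans
      (hδ _ (max_lt (max_lt ha hlt) hγ))
  -- the next closure point
  have hnext : ∀ w, ∃ δ, w < δ ∧ IsClosedPt F δ ∧ ∀ δ', w < δ' → IsClosedPt F δ' → δ ≤ δ' := by
    intro w
    have hne : {δ | w < δ ∧ IsClosedPt F δ}.Nonempty := exists_closedPt_gt F w
    exact ⟨wf.min _ hne, (wf.min_mem _ hne).1, (wf.min_mem _ hne).2,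
      fun δ' h h' => wf.min_le (s := {δ | w < δ ∧ IsClosedPt F δ}) ⟨h, h'⟩⟩
  choose nx hnx1 hnx2 hnx3 using hnext
  -- `m i` is the last closure point below `i`
  have hm : ∀ i δ, IsClosedPt F δ → δ ≤ i → i < nx δ →
      ∀ δ', IsClosedPt F δ' → δ' ≤ i → i < nx δ' → δ' = δ := by
    intro i δ hδ h1 h2 δ' hδ' h1' h2'
    refine le_antisymm ?_ ?_
    · by_contra! hlt
      exact absurd (h1'.trans_lt h2) (not_lt.2 (hnx3 _ _ hlt hδ'))
    · by_contra! hlt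
      exact absurd (h1.trans_lt h2') (not_lt.2 (hnx3 _ _ hlt hδ))
  have hlim : ∀ δ, IsClosedPt nx δ → IsClosedPt F δ := by
    intro δ hδ γ hγ
    exact (hnx2 γ γ (hnx1 γ)).trans (hδ γ hγ)
  obtain ⟨p, hp⟩ := exists_unbounded_fibers (W := W) hT (S := Set.range nx)
    (fun w => ⟨nx w, ⟨w, rfl⟩, (hnx1 w).le⟩)
  -- For active `a`, `k a δ` lies in the block `[δ, nx δ)`. Blocks of successor closure points carry
  -- the label `p δ`; blocks of limit closure points carry none, which makes the labelled sets
  -- nonstationary.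
  let q : W → Option T := fun i =>
    if h : ∃ δ, IsClosedPt F δ ∧ δ ≤ i ∧ i < nx δ ∧ ¬ IsClosedPt nx δ then some (p h.choose)
    else none
  have hq : ∀ a δ, IsClosedPt F δ → c a < δ → q (k a δ) =
      if IsClosedPt nx δ then none else some (p δ) := by
    intro a δ hδ ha
    have h1 := hk_ge δ hδ a ha
    have h2 : k a δ < nx δ :=
      hk_lt _ (hnx2 δ) a (ha.trans (hnx1 δ)) δ (hnx1 δ)
    by_cases hl : IsClosedPt nx δ
    · rw [if_pos hl]
      refine dif_neg ?_
      rintro ⟨δ', h1', h2', h3', h4'⟩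
      rw [hm _ δ hδ h1 h2 δ' h1' h2' h3'] at h4'
      exact h4' hl
    · rw [if_neg hl]
      have hex : ∃ δ', IsClosedPt F δ' ∧ δ' ≤ k a δ ∧ k a δ < nx δ' ∧ ¬ IsClosedPt nx δ' :=
        ⟨δ, hδ, h1, h2, hl⟩
      have : q (k a δ) = some (p hex.choose) := dif_pos hex
      rw [this, hm _ δ hδ h1 h2 _ hex.choose_spec.1 hex.choose_spec.2.1 hex.choose_spec.2.2.1]
  refine ⟨q, fun a => ⟨fun γ => max (nx γ) (c a), fun δ hδ hc γ => ?_⟩, fun a t ε => ?_⟩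
  · by_contra! hlt
    have h1 : IsClosedPt nx δ := fun γ hγ => (le_max_left _ _).trans_lt (hc γ hγ)
    refine hδ ?_
    rw [hq a δ (hlim δ h1) ((le_max_right _ _).trans_lt (hc γ hlt)), if_pos h1]
  · obtain ⟨_, ⟨w, rfl⟩, hlt, hpt⟩ := hp t (max ε (c a))
    have hca : c a < nx w := (le_max_right _ _).trans_lt hlt
    have hl : ¬ IsClosedPt nx (nx w) := fun h => lt_irrefl _ (h w (hnx1 w))
    refine ⟨nx w, ((le_max_left _ _).trans hlt.le).trans (hk_ge _ (hnx2 w) a hca), ?_⟩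
    rw [hq a _ (hnx2 w) hca, if_neg hl, hpt]

end

/-! ### Skeletons on `V × W` -/

/-- Recursion along a well-order with a side condition on the values constructed so far. -/
theorem exists_forall_of_step {V T : Type*} [LinearOrder V] [WellFoundedLT V] [Nonempty T]
    (R : (V → T) → V → Prop)
    (hcongr : ∀ d d' ν, (∀ μ ≤ ν, d μ = d' μ) → R d ν → R d' ν)
    (step : ∀ d ν, (∀ μ < ν, R d μ) → ∃ t, R (Function.update d ν t) ν) :
    ∃ d, ∀ ν, R d ν := by
  classical
  -- The default values from `ν` on are harmless: by `hcongr` the condition at `μ` sees only values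
  -- up to `μ`.
  let e : ∀ ν, (∀ μ, μ < ν → T) → V → T := fun ν r μ =>
    if h : μ < ν then r μ h else Classical.arbitrary T
  let F : ∀ ν, (∀ μ, μ < ν → T) → T := fun ν r =>
    if h : ∃ t, R (Function.update (e ν r) ν t) ν then h.choose else Classical.arbitrary T
  let d : V → T := wellFounded_lt.fix F
  have hd : ∀ ν, d ν = F ν (fun μ _ => d μ) := fun ν => WellFounded.fix_eq _ _ _
  refine ⟨d, fun ν => ?_⟩
  induction ν using WellFoundedLT.induction with
  | ind ν ih =>
    have he : ∀ μ < ν, e ν (fun μ _ => d μ) μ = d μ := fun μ hμ => dif_pos hμ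
    have hex := step (e ν (fun μ _ => d μ)) ν fun μ hμ =>
      hcongr d _ μ (fun κ hκ => (he κ (hκ.trans_lt hμ)).symm) (ih μ hμ)
    refine hcongr _ d ν (fun μ hμ => ?_) hex.choose_spec
    rcases hμ.lt_or_eq with h | rfl
    · rw [Function.update_of_ne h.ne, he μ h]
    · rw [Function.update_self, hd]
      exact (dif_pos hex).symm

/-- The data attached to one level of a skeleton on `V × W`: a function `k` enumerating pieces of
the part below the level, and the assignment `q` of some of these pieces to pairs `(ξ, ζ)`, where
`ξ` names a point of the level. -/
structure LevelData (V W : Type u) where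
  k : V × W → W
  q : W → Option (W × W)

section

variable {V W : Type u} [LinearOrder V] [LinearOrder W]

/-- The pair to which the piece of `z` is assigned at level `ν`. -/
def tag (d : V → LevelData V W) (ν : V) (z : V × W) : Option (W × W) :=
  (d ν).q ((d ν).k z)

/-- The cone of a point of the skeleton. -/
def skelCone (d : V → LevelData V W) (x : V × W) : Set (V × W) :=
  {z | z = x ∨ (z.1 < x.1 ∧ ∃ ζ, tag d x.1 z = some (x.2, ζ))}

/-- The basic neighbourhoods of a point of the skeleton. -/
def skelNhd (d : V → LevelData V W) (x : V × W) (ε : W) : Set (V × W) :=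
  {z | z = x ∨ (z.1 < x.1 ∧ ε ≤ (d x.1).k z ∧ ∃ ζ, tag d x.1 z = some (x.2, ζ))}

/-- The requirements on the data of a skeleton at level `ν`. -/
structure IsSkeletonAt (d : V → LevelData V W) (ν : V) : Prop where
  locConst : ∀ y : V × W, y.1 < ν → ∃ ε, ∀ z ∈ skelNhd d y ε, (d ν).k z = (d ν).k y
  bounded : ∀ x : V × W, x.1 < ν → ∃ ε, ∀ z ∈ skelCone d x, (d ν).k z < ε
  cover : ∀ ε, ∃ S : Set (V × W), S.Countable ∧ (∀ x ∈ S, x.1 < ν) ∧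
    ∀ z : V × W, z.1 < ν → (d ν).k z < ε → ∃ x ∈ S, z ∈ skelCone d x
  unbounded : ∀ μ < ν, ∀ t ε, ∃ η, ε ≤ (d ν).k (μ, η) ∧ tag d ν (μ, η) = some t
  nonstationary : ∀ μ < ν, IsNonstationary {η | tag d ν (μ, η) ≠ none}

theorem skelNhd_congr {d d' : V → LevelData V W} {x : V × W} (h : d x.1 = d' x.1) (ε : W) :
    skelNhd d x ε = skelNhd d' x ε := by
  simp only [skelNhd, tag, h]

omit [LinearOrder W] in
theorem skelCone_congr {d d' : V → LevelData V W} {x : V × W} (h : d x.1 = d' x.1) :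
    skelCone d x = skelCone d' x := by
  simp only [skelCone, tag, h]

omit [LinearOrder V] [LinearOrder W] in
theorem tag_congr {d d' : V → LevelData V W} {ν : V} (h : d ν = d' ν) (z : V × W) :
    tag d ν z = tag d' ν z := by
  simp only [tag, h]

theorem IsSkeletonAt.congr {d d' : V → LevelData V W} {ν : V} (h : ∀ μ ≤ ν, d μ = d' μ)
    (hd : IsSkeletonAt d ν) : IsSkeletonAt d' ν where
  locConst y hy := by
    rw [← h ν le_rfl]
    simp only [← skelNhd_congr (h y.1 hy.le)]
    exact hd.locConst y hy
  bounded x hx := by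
    rw [← h ν le_rfl, ← skelCone_congr (h x.1 hx.le)]
    exact hd.bounded x hx
  cover ε := by
    obtain ⟨S, hS, hS1, hS2⟩ := hd.cover ε
    refine ⟨S, hS, hS1, fun z hz hk => ?_⟩
    rw [← h ν le_rfl] at hk
    obtain ⟨x, hx, hzx⟩ := hS2 z hz hk
    exact ⟨x, hx, by rwa [← skelCone_congr (h x.1 (hS1 x hx).le)]⟩
  unbounded := by
    simp only [← h ν le_rfl, ← tag_congr (h ν le_rfl)]
    exact hd.unbounded
  nonstationary := by
    simp only [← tag_congr (h ν le_rfl)]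
    exact hd.nonstationary

theorem skelNhd_anti (d : V → LevelData V W) (x : V × W) {ε ε' : W} (h : ε ≤ ε') :
    skelNhd d x ε' ⊆ skelNhd d x ε := by
  rintro z (hz | ⟨h1, h2, h3⟩)
  · exact Or.inl hz
  · exact Or.inr ⟨h1, h.trans h2, h3⟩

theorem skelNhd_subset_skelCone (d : V → LevelData V W) (x : V × W) (ε : W) :
    skelNhd d x ε ⊆ skelCone d x := by
  rintro z (hz | ⟨h1, h2, h3⟩)
  · exact Or.inl hz
  · exact Or.inr ⟨h1, h3⟩

omit [LinearOrder W] in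
theorem fst_le_of_mem_skelCone {d : V → LevelData V W} {x z : V × W} (h : z ∈ skelCone d x) :
    z.1 ≤ x.1 := by
  rcases h with rfl | ⟨h, -⟩
  · exact le_rfl
  · exact h.le

/-- The cones of a skeleton are clopen. -/
theorem IsSkeletonAt.skelCone_locConst [Nonempty W] {d : V → LevelData V W} {x y : V × W}
    (hx : IsSkeletonAt d x.1) (hy : IsSkeletonAt d y.1) :
    ∃ ε, ∀ z ∈ skelNhd d y ε, (z ∈ skelCone d x ↔ y ∈ skelCone d x) := by
  rcases lt_trichotomy y.1 x.1 with h | h | h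
  · obtain ⟨ε, hε⟩ := hx.locConst y h
    refine ⟨ε, fun z hz => ?_⟩
    have hzx : z.1 < x.1 :=
      (fst_le_of_mem_skelCone (skelNhd_subset_skelCone _ _ _ hz)).trans_lt h
    have h1 : z ≠ x := fun e => by rw [e] at hzx; exact lt_irrefl _ hzx
    have h2 : y ≠ x := fun e => by rw [e] at h; exact lt_irrefl _ h
    change (z = x ∨ _) ↔ (y = x ∨ _)
    simp only [h1, h2, hzx, h, false_or, true_and, tag, hε z hz]
  · by_cases hyx : y = x
    · subst hyx
      exact ⟨Classical.arbitrary W, fun z hz =>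
        ⟨fun _ => Or.inl rfl, fun _ => skelNhd_subset_skelCone _ _ _ hz⟩⟩
    · refine ⟨Classical.arbitrary W, fun z hz => ?_⟩
      rcases hz with rfl | ⟨h1, -, ζ, h3⟩
      · rfl
      · refine ⟨fun hz => ?_, fun hy => ?_⟩
        · exfalso
          rcases hz with rfl | ⟨-, ζ', h3'⟩
          · rw [h] at h1; exact lt_irrefl _ h1
          · rw [← h, h3] at h3'
            simp only [Option.some.injEq, Prod.mk.injEq] at h3'
            exact hyx (Prod.ext h h3'.1)
        · exfalso
          rcases hy with rfl | ⟨hlt, -⟩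
          · exact hyx rfl
          · rw [h] at hlt; exact lt_irrefl _ hlt
  · obtain ⟨ε, hε⟩ := hy.bounded x h
    refine ⟨ε, fun z hz => ?_⟩
    rcases hz with rfl | ⟨h1, h2, -⟩
    · rfl
    · refine ⟨fun hz => absurd (hε z hz) (not_lt.2 h2), fun hy => ?_⟩
      exact absurd (fst_le_of_mem_skelCone hy) (not_le.2 h)

/-- Below `x` the trace consists of tagged points; at or above the level of `x` it contains at most
`x` itself. -/
theorem IsSkeletonAt.isNonstationary_skelCone {d : V → LevelData V W} {x : V × W}
    (hx : IsSkeletonAt d x.1) (μ : V) : IsNonstationary {η | (μ, η) ∈ skelCone d x} := by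
  by_cases h : μ < x.1
  · refine (hx.nonstationary μ h).mono ?_
    rintro η (rfl | ⟨-, ζ, hζ⟩)
    · exact absurd h (lt_irrefl _)
    · simp [hζ]
  · refine isNonstationary_of_forall_le x.2 ?_
    rintro η (rfl | ⟨h1, -⟩)
    · exact le_rfl
    · exact absurd h1 h

variable [hW : IsOmegaOne W]

/-- The new `k z` is the least index of a cone containing `z`, so its fibres are the lower cones
made disjoint. They lie inside cones and hence have nonstationary traces, as `exists_selector`
needs. -/
theorem IsSkeletonAt.exists_step (hV : ∀ ν : V, #(Set.Iio ν) ≤ ℵ_ 1) (d : V → LevelData V W)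
    (ν : V) (hd : ∀ μ < ν, IsSkeletonAt d μ) :
    ∃ t, IsSkeletonAt (Function.update d ν t) ν := by
  classical
  have := hW.wf
  have wf : WellFounded ((· < ·) : W → W → Prop) := wellFounded_lt
  have : Nonempty W := IsOmegaOne.nonempty
  have hWW : #(W × W) ≤ ℵ_ 1 := by
    rw [Cardinal.mk_prod, Cardinal.lift_id, hW.card_eq,
      Cardinal.mul_eq_self (Cardinal.aleph0_le_aleph 1)]
  obtain ⟨e⟩ : Nonempty ({x : V × W // x.1 < ν} ↪ W) := by
    have : #{x : V × W // x.1 < ν} ≤ #W := by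
      have h1 : #{x : V × W // x.1 < ν} ≤ #(Set.Iio ν × W) :=
        Cardinal.mk_le_of_injective (f := fun x => (⟨x.1.1, x.2⟩, x.1.2)) (by
          rintro ⟨⟨a, b⟩, ha⟩ ⟨⟨a', b'⟩, ha'⟩ h
          have h' := Prod.ext_iff.1 h
          exact Subtype.ext (Prod.ext (congrArg Subtype.val h'.1) h'.2))
      refine h1.trans ?_
      rw [Cardinal.mk_prod, Cardinal.lift_id, Cardinal.lift_id, hW.card_eq]
      exact (mul_le_mul' (hV ν) le_rfl).trans
        (Cardinal.mul_eq_self (Cardinal.aleph0_le_aleph 1)).le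
    exact this
  have hk : ∀ z : V × W, ∃ w, z.1 < ν →
      (∃ x : {x : V × W // x.1 < ν}, e x = w ∧ z ∈ skelCone d x) ∧
        ∀ x : {x : V × W // x.1 < ν}, z ∈ skelCone d x → w ≤ e x := by
    intro z
    by_cases hz : z.1 < ν
    · have hne : {w | ∃ x : {x : V × W // x.1 < ν}, e x = w ∧ z ∈ skelCone d x}.Nonempty :=
        ⟨e ⟨z, hz⟩, ⟨z, hz⟩, rfl, Or.inl rfl⟩
      exact ⟨wf.min _ hne, fun _ => ⟨wf.min_mem _ hne, fun x hx =>
        wf.min_le (s := {w | ∃ x : {x : V × W // x.1 < ν}, e x = w ∧ z ∈ skelCone d x})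
          ⟨x, rfl, hx⟩⟩⟩
    · exact ⟨Classical.arbitrary W, fun h => absurd h hz⟩
  choose k hk using hk
  have hfib : ∀ (a : Set.Iio ν) i, IsNonstationary {η | k (a, η) = i} := by
    intro a i
    by_cases hi : ∃ x, e x = i
    · obtain ⟨x, rfl⟩ := hi
      refine ((hd _ x.2).isNonstationary_skelCone a).mono fun η hη => ?_
      obtain ⟨⟨x', hx', hm⟩, -⟩ := hk (a, η) a.2
      have : x' = x := e.injective (hx'.trans hη)
      subst this
      exact hm
    · refine isNonstationary_of_forall_le (Classical.arbitrary W) fun η hη => ?_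
      obtain ⟨⟨x', hx', hm⟩, -⟩ := hk (a, η) a.2
      exact absurd ⟨x', hx'.trans hη⟩ hi
  obtain ⟨q, hq1, hq2⟩ := exists_selector hWW (hV ν) (fun (a : Set.Iio ν) η => k (a, η)) hfib
  refine ⟨⟨k, q⟩, ?_⟩
  have hlt : ∀ μ < ν, d μ = Function.update d ν ⟨k, q⟩ μ := fun μ hμ =>
    (Function.update_of_ne hμ.ne _ _).symm
  refine ⟨fun y hy => ?_, fun x hx => ?_, fun ε => ?_, fun μ hμ t ε => ?_, fun μ hμ => ?_⟩
  · rw [Function.update_self]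
    simp only [← skelNhd_congr (hlt y.1 hy)]
    -- Only countably many clopen cones decide the value `k y`, so one `ε` serves all of them.
    have hc : {x : {x : V × W // x.1 < ν} | e x ≤ k y}.Countable :=
      (hW.countable_Iic (k y)).preimage e.injective
    have h1 : ∀ x : {x : V × W // x.1 < ν},
        ∃ ε, ∀ z ∈ skelNhd d y ε, (z ∈ skelCone d x ↔ y ∈ skelCone d x) := fun x =>
      (hd _ x.2).skelCone_locConst (hd _ hy)
    choose E hE using h1
    obtain ⟨ε, hε⟩ := exists_forall_lt_of_countable (hc.image E)
    have hE' : ∀ z ∈ skelNhd d y ε, ∀ x, e x ≤ k y → (z ∈ skelCone d x ↔ y ∈ skelCone d x) :=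
      fun z hz x hx => hE x z (skelNhd_anti d y (hε _ ⟨x, hx, rfl⟩).le hz)
    refine ⟨ε, fun z hz => ?_⟩
    have hzν : z.1 < ν :=
      (fst_le_of_mem_skelCone (skelNhd_subset_skelCone _ _ _ hz)).trans_lt hy
    obtain ⟨⟨x, hx, hyx⟩, hmin⟩ := hk y hy
    obtain ⟨⟨x', hx', hzx'⟩, hmin'⟩ := hk z hzν
    have hle : k z ≤ k y := by
      rw [← hx]; exact hmin' x ((hE' z hz x hx.le).2 hyx)
    refine le_antisymm hle ?_
    rw [← hx']
    exact hmin x' ((hE' z hz x' (hx'.le.trans hle)).1 hzx')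
  · rw [Function.update_self, ← skelCone_congr (hlt x.1 hx)]
    obtain ⟨ε, hε⟩ := exists_forall_lt fun _ : Unit => e ⟨x, hx⟩
    exact ⟨ε, fun z hz => ((hk z ((fst_le_of_mem_skelCone hz).trans_lt hx)).2 ⟨x, hx⟩
      hz).trans_lt (hε ())⟩
  · rw [Function.update_self]
    refine ⟨Subtype.val '' {x : {x : V × W // x.1 < ν} | e x ≤ ε},
      ((hW.countable_Iic ε).preimage e.injective).image _, ?_, fun z hz hzε => ?_⟩
    · rintro _ ⟨x, -, rfl⟩
      exact x.2
    · obtain ⟨⟨x, hx, hzx⟩, -⟩ := hk z hz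
      refine ⟨x, ⟨x, (hx.le.trans hzε.le : e x ≤ ε), rfl⟩, ?_⟩
      rwa [← skelCone_congr (hlt _ x.2)]
  · simp only [tag, Function.update_self]
    exact hq2 ⟨μ, hμ⟩ t ε
  · simp only [tag, Function.update_self]
    exact hq1 ⟨μ, hμ⟩

theorem exists_skeleton [WellFoundedLT V] (hV : ∀ ν : V, #(Set.Iio ν) ≤ ℵ_ 1) :
    ∃ d : V → LevelData V W, ∀ ν, IsSkeletonAt d ν := by
  have : Nonempty (LevelData V W) :=
    ⟨⟨fun _ => (IsOmegaOne.nonempty (W := W)).some, fun _ => none⟩⟩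
  exact exists_forall_of_step IsSkeletonAt (fun d d' ν h hd => hd.congr h)
    (IsSkeletonAt.exists_step hV)

end

/-! ### Generalities on P-spaces and Lindelöf sets -/

theorem IsPSpace.iInter_mem_nhds {X : Type u} [TopologicalSpace X] (h : IsPSpace X) {x : X}
    {A : ℕ → Set X} (hA : ∀ n, A n ∈ 𝓝 x) : (⋂ n, A n) ∈ 𝓝 x := by
  choose O hO hO' hx using fun n => mem_nhds_iff.1 (hA n)
  exact mem_nhds_iff.2 ⟨⋂ n, O n, Set.iInter_mono hO, h O hO', Set.mem_iInter.2 hx⟩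

theorem isLindelof_of_isLindelof_diff {X : Type u} [TopologicalSpace X] {K S : Set X}
    (hK : IsLindelof K) (hKS : K ⊆ S) (h : ∀ O, IsOpen O → K ⊆ O → IsLindelof (S \ O)) :
    IsLindelof S := by
  refine isLindelof_of_countable_subcover fun {ι} U hU hSU => ?_
  obtain ⟨r, hr, hKr⟩ := hK.elim_countable_subcover U hU (hKS.trans hSU)
  obtain ⟨r', hr', hSr⟩ := (h _ (isOpen_biUnion fun i _ => hU i) hKr).elim_countable_subcover U hU
    (Set.sdiff_subset.trans hSU)
  refine ⟨r ∪ r', hr.union hr', fun x hx => ?_⟩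
  rw [Set.biUnion_union]
  by_cases hxr : x ∈ ⋃ i ∈ r, U i
  · exact Or.inl hxr
  · exact Or.inr (hSr ⟨hx, hxr⟩)

theorem t2Space_of_clopen {X : Type u} [TopologicalSpace X]
    (h : ∀ x y : X, x ≠ y → ∃ A, IsClopen A ∧ ((x ∈ A ∧ y ∉ A) ∨ (y ∈ A ∧ x ∉ A))) :
    T2Space X := by
  refine ⟨fun x y hxy => ?_⟩
  obtain ⟨A, hA, h | h⟩ := h x y hxy
  · exact ⟨A, Aᶜ, hA.isOpen, hA.compl.isOpen, h.1, h.2, disjoint_compl_right⟩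
  · exact ⟨Aᶜ, A, hA.compl.isOpen, hA.isOpen, h.2, h.1, disjoint_compl_left⟩

/-! ### Blow-ups of a skeleton -/

/-- The set underlying the space obtained from a skeleton by replacing its points at level `ν`
with copies of `Y ν`; the basic neighbourhoods of such a copy below it are distributed among the
points `t ν ζ`. -/
structure Blowup {V W : Type u} (d : V → LevelData V W) {Y : V → Type u} (t : ∀ ν, W → Y ν) :
    Type u where
  fst : V × W
  snd : Y fst.1

namespace Blowup

variable {V W : Type u} [LinearOrder V] [LinearOrder W] {d : V → LevelData V W}
  {Y : V → Type u} {t : ∀ ν, W → Y ν}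

/-- The basic neighbourhoods, for `A` a set in the copy of `Y p.1` at `p`. -/
def nbhd (d : V → LevelData V W) (t : ∀ ν, W → Y ν) (p : V × W) (A : Set (Y p.1)) (ε : W) :
    Set (Blowup d t) :=
  {z | (∃ y ∈ A, z = ⟨p, y⟩) ∨
    (z.1.1 < p.1 ∧ ε ≤ (d p.1).k z.1 ∧ ∃ ζ, tag d p.1 z.1 = some (p.2, ζ) ∧ t p.1 ζ ∈ A)}

theorem nbhd_mono {p : V × W} {A A' : Set (Y p.1)} {ε ε' : W} (hA : A ⊆ A') (hε : ε' ≤ ε) :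
    nbhd d t p A ε ⊆ nbhd d t p A' ε' := by
  rintro z (⟨y, hy, rfl⟩ | ⟨h1, h2, ζ, h3, h4⟩)
  · exact Or.inl ⟨y, hA hy, rfl⟩
  · exact Or.inr ⟨h1, hε.trans h2, ζ, h3, hA h4⟩

theorem fst_mem_skelNhd {p : V × W} {A : Set (Y p.1)} {ε : W} {z : Blowup d t}
    (hz : z ∈ nbhd d t p A ε) : z.1 ∈ skelNhd d p ε := by
  rcases hz with ⟨y, -, rfl⟩ | ⟨h1, h2, ζ, h3, -⟩
  · exact Or.inl rfl
  · exact Or.inr ⟨h1, h2, ζ, h3⟩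

theorem mk_mem_nbhd {p : V × W} {A : Set (Y p.1)} {ε : W} {y : Y p.1} :
    (⟨p, y⟩ : Blowup d t) ∈ nbhd d t p A ε ↔ y ∈ A := by
  constructor
  · rintro (⟨y', hy', h⟩ | ⟨h, -⟩)
    · cases h; exact hy'
    · exact absurd h (lt_irrefl _)
  · exact fun hy => Or.inl ⟨y, hy, rfl⟩

variable [∀ ν, TopologicalSpace (Y ν)] [hW : IsOmegaOne W]

instance : TopologicalSpace (Blowup d t) where
  IsOpen O := ∀ p y, (⟨p, y⟩ : Blowup d t) ∈ O → ∃ A ∈ 𝓝 y, ∃ ε, nbhd d t p A ε ⊆ O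
  isOpen_univ p y _ := ⟨Set.univ, Filter.univ_mem, IsOmegaOne.nonempty.some, Set.subset_univ _⟩
  isOpen_inter O O' hO hO' p y hy := by
    obtain ⟨A, hA, ε, h⟩ := hO p y hy.1
    obtain ⟨A', hA', ε', h'⟩ := hO' p y hy.2
    exact ⟨A ∩ A', Filter.inter_mem hA hA', max ε ε', Set.subset_inter
      ((nbhd_mono Set.inter_subset_left (le_max_left _ _)).trans h)
      ((nbhd_mono Set.inter_subset_right (le_max_right _ _)).trans h')⟩
  isOpen_sUnion s hs p y hy := by
    obtain ⟨O, hO, hy⟩ := hy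
    obtain ⟨A, hA, ε, h⟩ := hs O hO p y hy
    exact ⟨A, hA, ε, h.trans (Set.subset_sUnion_of_mem hO)⟩

theorem isOpen_iff {O : Set (Blowup d t)} : IsOpen O ↔
    ∀ p y, (⟨p, y⟩ : Blowup d t) ∈ O → ∃ A ∈ 𝓝 y, ∃ ε, nbhd d t p A ε ⊆ O := Iff.rfl

theorem exists_nbhd_subset {N : Set (Blowup d t)} {p : V × W} {y : Y p.1}
    (hN : N ∈ 𝓝 (⟨p, y⟩ : Blowup d t)) : ∃ A ∈ 𝓝 y, ∃ ε, nbhd d t p A ε ⊆ N := by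
  obtain ⟨O, hON, hO, hy⟩ := mem_nhds_iff.1 hN
  obtain ⟨A, hA, ε, h⟩ := isOpen_iff.1 hO p y hy
  exact ⟨A, hA, ε, h.trans hON⟩

theorem isClopen_of_locConst {O : Set (Blowup d t)}
    (h : ∀ p y, ∃ A ∈ 𝓝 y, ∃ ε, ∀ w ∈ nbhd d t p A ε, (w ∈ O ↔ (⟨p, y⟩ : Blowup d t) ∈ O)) :
    IsClopen O := by
  refine ⟨⟨isOpen_iff.2 fun p y hy => ?_⟩, isOpen_iff.2 fun p y hy => ?_⟩
  · obtain ⟨A, hA, ε, h⟩ := h p y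
    exact ⟨A, hA, ε, fun w hw hwO => hy ((h w hw).1 hwO)⟩
  · obtain ⟨A, hA, ε, h⟩ := h p y
    exact ⟨A, hA, ε, fun w hw => (h w hw).2 hy⟩

theorem continuous_mk (p : V × W) : Continuous fun y : Y p.1 => (⟨p, y⟩ : Blowup d t) := by
  refine ⟨fun O hO => isOpen_iff_mem_nhds.2 fun y hy => ?_⟩
  obtain ⟨A, hA, ε, h⟩ := isOpen_iff.1 hO p y hy
  exact Filter.mem_of_superset hA fun y' hy' => h (mk_mem_nbhd.2 hy')

theorem isPSpace (hY : ∀ ν, IsPSpace (Y ν)) : IsPSpace (Blowup d t) := by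
  intro O hO
  refine isOpen_iff.2 fun p y hy => ?_
  choose A hA E h using fun n => isOpen_iff.1 (hO n) p y (Set.mem_iInter.1 hy n)
  obtain ⟨ε, hε⟩ := exists_forall_lt E
  exact ⟨⋂ n, A n, (hY _).iInter_mem_nhds hA, ε, Set.subset_iInter fun n =>
    (nbhd_mono (Set.iInter_subset _ n) (hε n).le).trans (h n)⟩

section

variable (hd : ∀ ν, IsSkeletonAt d ν)

include hd

theorem isClopen_preimage_skelCone (x : V × W) :
    IsClopen {z : Blowup d t | z.1 ∈ skelCone d x} := by
  have : Nonempty W := IsOmegaOne.nonempty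
  refine isClopen_of_locConst fun p y => ?_
  obtain ⟨ε, hε⟩ := (hd x.1).skelCone_locConst (hd p.1)
  exact ⟨Set.univ, Filter.univ_mem, ε, fun w hw => hε _ (fst_mem_skelNhd hw)⟩

/-- Inside the copy at `p` this is clopenness of `A`, each piece having a single tag; below `p`
membership depends only on the locally constant `k`; elsewhere the clopen cone of `p` is avoided. -/
theorem isClopen_nbhd {p : V × W} {A : Set (Y p.1)} (hA : IsClopen A) (ε : W) :
    IsClopen (nbhd d t p A ε) := by
  have hne : Nonempty W := IsOmegaOne.nonempty
  refine isClopen_of_locConst fun x y => ?_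
  by_cases hx : x ∈ skelCone d p
  · rcases hx with rfl | ⟨hlt, -⟩
    · by_cases hy : y ∈ A
      · exact ⟨A, hA.isOpen.mem_nhds hy, ε, fun w hw => ⟨fun _ => mk_mem_nbhd.2 hy, fun _ => hw⟩⟩
      · refine ⟨Aᶜ, hA.compl.isOpen.mem_nhds hy, ε, fun w hw => ?_⟩
        refine ⟨fun hw' => ?_, fun h => absurd (mk_mem_nbhd.1 h) hy⟩
        exfalso
        rcases hw with ⟨y', hy', rfl⟩ | ⟨h1, -, ζ, h3, h4⟩
        · exact hy' (mk_mem_nbhd.1 hw')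
        · rcases hw' with ⟨y', hy', rfl⟩ | ⟨-, -, ζ', h3', h4'⟩
          · exact lt_irrefl _ h1
          · rw [h3] at h3'
            simp only [Option.some.injEq, Prod.mk.injEq, true_and] at h3'
            rw [h3'] at h4
            exact h4 h4'
    · obtain ⟨ε', hε'⟩ := (hd p.1).locConst x hlt
      refine ⟨Set.univ, Filter.univ_mem, ε', fun w hw => ?_⟩
      have hw1 := fst_mem_skelNhd hw
      have hwlt : w.1.1 < p.1 :=
        (fst_le_of_mem_skelCone (skelNhd_subset_skelCone _ _ _ hw1)).trans_lt hlt
      have h1 : ¬ ∃ y ∈ A, w = ⟨p, y⟩ := by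
        rintro ⟨y', -, rfl⟩; exact lt_irrefl _ hwlt
      have h2 : ¬ ∃ y' ∈ A, (⟨x, y⟩ : Blowup d t) = ⟨p, y'⟩ := by
        rintro ⟨y', -, h⟩
        have : x = p := congrArg Blowup.fst h
        rw [this] at hlt; exact lt_irrefl _ hlt
      change (_ ∨ _) ↔ (_ ∨ _)
      simp only [h1, h2, hwlt, hlt, false_or, true_and, tag, hε' _ hw1]
  · obtain ⟨ε', hε'⟩ := (hd p.1).skelCone_locConst (hd x.1) (y := x) (x := p)
    refine ⟨Set.univ, Filter.univ_mem, ε', fun w hw => ?_⟩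
    have hw1 : w.1 ∉ skelCone d p := fun h => hx ((hε' _ (fst_mem_skelNhd hw)).1 h)
    exact ⟨fun h => absurd (skelNhd_subset_skelCone _ _ _ (fst_mem_skelNhd h)) hw1,
      fun h => absurd (skelNhd_subset_skelCone _ _ _ (fst_mem_skelNhd h)) hx⟩

variable [WellFoundedLT V] [∀ ν, LindelofSpace (Y ν)]

-- Lindelöfness of the copy at `p` yields a countable subcover, hence one `ε` beyond all the bounds;
-- every label `t p.1 ζ` lies in a member of the subcover.
omit hd [WellFoundedLT V] in
theorem exists_skelNhd_subset {O : Set (Blowup d t)} (hO : IsOpen O) {p : V × W}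
    (hp : ∀ y, (⟨p, y⟩ : Blowup d t) ∈ O) : ∃ ε, ∀ z : Blowup d t, z.1 ∈ skelNhd d p ε → z ∈ O := by
  choose A hA E hE using fun y => isOpen_iff.1 hO p y (hp y)
  obtain ⟨s, hs, hsA⟩ := LindelofSpace.elim_nhds_subcover A hA
  obtain ⟨ε, hε⟩ := exists_forall_lt_of_countable (hs.image E)
  refine ⟨ε, ?_⟩
  rintro ⟨x, y⟩ (h | ⟨h1, h2, ζ, h3⟩)
  · dsimp only at h
    subst h
    exact hp y
  · obtain ⟨y', hy', hζ⟩ := Set.mem_iUnion₂.1 (hsA.ge (Set.mem_univ (t p.1 ζ)))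
    exact hE y' (Or.inr ⟨h1, (hε _ ⟨y', hy', rfl⟩).le.trans h2, ζ, h3, hζ⟩)

/-- An open set around the copy at `p` omits only pieces of index below some `ε`; these lie in
countably many lower cones, Lindelöf by induction. -/
theorem isLindelof_preimage_skelCone (p : V × W) :
    IsLindelof {z : Blowup d t | z.1 ∈ skelCone d p} := by
  obtain ⟨ν, ξ⟩ := p
  induction ν using WellFoundedLT.induction generalizing ξ with
  | ind ν ih =>
    refine isLindelof_of_isLindelof_diff
      (isLindelof_range (continuous_mk (d := d) (t := t) (ν, ξ))) ?_ fun O hO hsub => ?_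
    · rintro _ ⟨y, rfl⟩
      exact Or.inl rfl
    · obtain ⟨ε, hε⟩ := exists_skelNhd_subset hO fun y => hsub ⟨y, rfl⟩
      obtain ⟨S, hS, hSlt, hcov⟩ := (hd ν).cover ε
      have hL : IsLindelof (⋃ x ∈ S, {z : Blowup d t | z.1 ∈ skelCone d x}) :=
        hS.isLindelof_biUnion fun x hx => ih x.1 (hSlt x hx) x.2
      refine hL.of_isClosed_subset
        ((isClopen_preimage_skelCone hd _).isClosed.sdiff hO) ?_
      rintro z ⟨hz, hzO⟩
      rcases hz with h | ⟨h1, h2⟩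
      · exact absurd (hε z (Or.inl h)) hzO
      · have hk : (d ν).k z.1 < ε := by
          by_contra! hle
          exact hzO (hε z (Or.inr ⟨h1, hle, h2⟩))
        obtain ⟨x, hx, hzx⟩ := hcov z.1 h1 hk
        exact Set.mem_biUnion hx hzx

omit [WellFoundedLT V] [∀ ν, LindelofSpace (Y ν)] in
/-- Lindelöf sets have a nonstationary trace on every level of the skeleton. -/
theorem isNonstationary_of_isLindelof {K : Set (Blowup d t)} (hK : IsLindelof K) (ν : V) :
    IsNonstationary {η | ∃ y, (⟨(ν, η), y⟩ : Blowup d t) ∈ K} := by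
  obtain ⟨S, hS, hKS⟩ := hK.elim_countable_subcover
    (fun x : V × W => {z : Blowup d t | z.1 ∈ skelCone d x})
    (fun x => (isClopen_preimage_skelCone hd x).isOpen)
    (fun z _ => Set.mem_iUnion.2 ⟨z.1, Or.inl rfl⟩)
  refine (IsNonstationary.biUnion hS fun x _ =>
    (hd x.1).isNonstationary_skelCone ν).mono ?_
  rintro η ⟨y, hy⟩
  obtain ⟨x, hx, hm⟩ := Set.mem_iUnion₂.1 (hKS hy)
  exact Set.mem_biUnion hx hm

/-- The rank function of a blow-up, if the copies at level `ν` start at rank `h ν`. -/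
noncomputable def rk (d : V → LevelData V W) (t : ∀ ν, W → Y ν) (ρ : ∀ ν, Y ν → Ordinal.{u})
    (h : V → Ordinal.{u}) (z : Blowup d t) : Ordinal.{u} :=
  h z.1.1 + ρ z.1.1 z.2

variable {ρ : ∀ ν, Y ν → Ordinal.{u}} {h b : V → Ordinal.{u}} {α : Ordinal.{u}}
  (hY : ∀ ν, IsRankedSpace (Y ν) (ρ ν) (b ν + 1))
  (ht : ∀ ν y, ρ ν y = 0 → ∃ ζ, t ν ζ = y)
  (hb : ∀ μ ν, μ < ν → h μ + b μ < h ν) (hbα : ∀ ν, h ν + b ν < α)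
  (hcov : ∀ γ < α, ∃ ν, h ν ≤ γ ∧ γ ≤ h ν + b ν)

include hY

omit [WellFoundedLT V] hd [∀ ν, LindelofSpace (Y ν)] hW [LinearOrder V] [LinearOrder W] in
theorem rk_le (z : Blowup d t) : rk d t ρ h z ≤ h z.1.1 + b z.1.1 := by
  unfold rk
  gcongr
  exact Order.lt_add_one_iff.1 ((hY _).rank_lt z.2)

include hb hbα hcov ht

theorem isRankedSpace : IsRankedSpace (Blowup d t) (rk d t ρ h) α where
  t2 := by
    refine t2Space_of_clopen fun x y hxy => ?_
    have hne : Nonempty W := IsOmegaOne.nonempty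
    obtain ⟨p, x⟩ := x
    obtain ⟨p', y⟩ := y
    by_cases hp : p = p'
    · subst hp
      have hxy' : x ≠ y := fun e => hxy (by rw [e])
      have := (hY p.1).t2
      obtain ⟨A, hA, -, hxA, hAy⟩ := (hY p.1).basis x {y}ᶜ isOpen_compl_singleton hxy'
      exact ⟨nbhd d t p A hne.some, isClopen_nbhd hd hA _,
        Or.inl ⟨mk_mem_nbhd.2 hxA, fun hy => hAy (mk_mem_nbhd.1 hy) rfl⟩⟩
    -- The cone of a point contains no other point of the same or a higher level.
    · rcases le_total p.1 p'.1 with hle | hle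
      · refine ⟨_, isClopen_preimage_skelCone hd p, Or.inl ⟨Or.inl rfl, ?_⟩⟩
        rintro (h | ⟨h, -⟩)
        · exact hp h.symm
        · exact absurd h (not_lt.2 hle)
      · refine ⟨_, isClopen_preimage_skelCone hd p', Or.inr ⟨Or.inl rfl, ?_⟩⟩
        rintro (h | ⟨h, -⟩)
        · exact hp h
        · exact absurd h (not_lt.2 hle)
  pSpace := isPSpace fun ν => (hY ν).pSpace
  basis := by
    rintro ⟨p, y⟩ O hO hy
    obtain ⟨A, hA, ε, hAO⟩ := isOpen_iff.1 hO p y hy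
    obtain ⟨B, hB, -, hyB, hBA⟩ := (hY p.1).basis y (interior A) isOpen_interior
      (mem_interior_iff_mem_nhds.2 hA)
    refine ⟨nbhd d t p B ε, isClopen_nbhd hd hB ε, ?_, mk_mem_nbhd.2 hyB,
      (nbhd_mono (hBA.trans interior_subset) le_rfl).trans hAO⟩
    exact (isLindelof_preimage_skelCone hd p).of_isClosed_subset (isClopen_nbhd hd hB ε).isClosed
      fun z hz => skelNhd_subset_skelCone _ _ _ (fst_mem_skelNhd hz)
  cone := by
    have hne : Nonempty W := IsOmegaOne.nonempty
    rintro ⟨p, y⟩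
    obtain ⟨A, hA, hAy⟩ := (hY p.1).cone y
    obtain ⟨B, hB, -, hyB, hBA⟩ := (hY p.1).basis y (interior A) isOpen_interior
      (mem_interior_iff_mem_nhds.2 hA)
    refine ⟨nbhd d t p B hne.some,
      (isClopen_nbhd hd hB _).isOpen.mem_nhds (mk_mem_nbhd.2 hyB), ?_⟩
    rintro z (⟨y', hy', rfl⟩ | ⟨h1, -⟩) hzne
    · have : y' ≠ y := fun e => hzne (by rw [e])
      exact add_lt_add_right (hAy y' (interior_subset (hBA hy')) this) _
    · exact ((rk_le hY z).trans_lt (hb _ _ h1)).trans_le le_self_add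
  meets := by
    rintro ⟨p, y⟩ N hN γ hγ
    obtain ⟨A, hA, ε, hAN⟩ := exists_nbhd_subset hN
    have hγ' : γ < h p.1 + ρ p.1 y := hγ
    rcases le_or_gt (h p.1) γ with hle | hlt
    · obtain ⟨γ', rfl⟩ := exists_add_of_le hle
      obtain ⟨y', hy', rfl⟩ := (hY p.1).meets y A hA γ' (lt_of_add_lt_add_left hγ')
      exact ⟨⟨p, y'⟩, hAN (mk_mem_nbhd.2 hy'), rfl⟩
    · obtain ⟨μ, h1, h2⟩ := hcov γ (hlt.trans_le (le_self_add.trans (hbα p.1).le))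
      have hμ : μ < p.1 := by
        by_contra! hle
        rcases hle.lt_or_eq with h' | h'
        · exact absurd (hlt.trans_le (le_self_add.trans (hb _ _ h').le)) (not_lt.2 h1)
        · rw [h'] at hlt; exact absurd hlt (not_lt.2 h1)
      obtain ⟨γ', rfl⟩ := exists_add_of_le h1
      obtain ⟨w, rfl⟩ := (hY μ).exists_rank γ'
        (Order.lt_add_one_iff.2 (le_of_add_le_add_left h2))
      -- Lower pieces are attached to rank-zero points of the copy only; every neighbourhood in the
      -- copy contains such a point.
      obtain ⟨y₀, hy₀, hρ⟩ : ∃ y₀ ∈ A, ρ p.1 y₀ = 0 := by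
        rcases eq_or_ne (ρ p.1 y) 0 with h0 | h0
        · exact ⟨y, mem_of_mem_nhds hA, h0⟩
        · exact (hY p.1).meets y A hA 0 (pos_iff_ne_zero.2 h0)
      obtain ⟨ζ, hζ⟩ := ht p.1 y₀ hρ
      obtain ⟨η, hη1, hη2⟩ := (hd p.1).unbounded μ hμ (p.2, ζ) ε
      exact ⟨⟨(μ, η), w⟩, hAN (Or.inr ⟨hμ, hη1, ζ, hη2, hζ ▸ hy₀⟩), rfl⟩
  rank_lt z := (rk_le hY z).trans_lt (hbα _)
  exists_rank γ hγ := by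
    have hne : Nonempty W := IsOmegaOne.nonempty
    obtain ⟨ν, h1, h2⟩ := hcov γ hγ
    obtain ⟨γ', rfl⟩ := exists_add_of_le h1
    obtain ⟨y, rfl⟩ := (hY ν).exists_rank γ' (Order.lt_add_one_iff.2 (le_of_add_le_add_left h2))
    exact ⟨⟨(ν, hne.some), y⟩, rfl⟩
  card_le γ := by
    by_cases hγ : ∃ z, rk d t ρ h z = γ
    · obtain ⟨⟨⟨ν, ξ⟩, y⟩, rfl⟩ := hγ
      have hsub : {x | rk d t ρ h x = rk d t ρ h ⟨(ν, ξ), y⟩} ⊆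
          Set.range fun q : W × {y' | ρ ν y' = ρ ν y} => (⟨(ν, q.1), q.2⟩ : Blowup d t) := by
        rintro ⟨⟨μ, η⟩, y'⟩ hx
        have hx : h μ + ρ μ y' = h ν + ρ ν y := hx
        -- Different levels occupy disjoint intervals of ranks.
        have key : ∀ (z z' : Blowup d t), rk d t ρ h z = rk d t ρ h z' → ¬ z.1.1 < z'.1.1 :=
          fun z z' he hlt => absurd ((rk_le hY z).trans_lt (hb _ _ hlt))
            (not_lt.2 (he ▸ le_self_add))
        obtain rfl : μ = ν := le_antisymm
          (not_lt.1 (key ⟨(ν, ξ), y⟩ ⟨(μ, η), y'⟩ hx.symm))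
          (not_lt.1 (key ⟨(μ, η), y'⟩ ⟨(ν, ξ), y⟩ hx))
        exact ⟨(η, ⟨y', add_left_cancel hx⟩), rfl⟩
      refine (Cardinal.mk_le_mk_of_subset hsub).trans (Cardinal.mk_range_le.trans ?_)
      rw [Cardinal.mk_prod, Cardinal.lift_id, Cardinal.lift_id, hW.card_eq]
      exact (mul_le_mul' le_rfl ((hY ν).card_le _)).trans
        (Cardinal.mul_eq_self (Cardinal.aleph0_le_aleph 1)).le
    · have : {x | rk d t ρ h x = γ} = ∅ :=
        Set.eq_empty_iff_forall_notMem.2 fun z hz => hγ ⟨z, hz⟩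
      rw [this]
      simp

-- One point `y` of the right rank has a copy at each `(ν, η)`; the indices `η` whose copy of `Y ν`
-- meets `K` form a nonstationary set.
omit [WellFoundedLT V] [∀ ν, LindelofSpace (Y ν)] ht hb hbα in
theorem not_countable_level_diff {K : Set (Blowup d t)} (hK : IsLindelof K) {γ : Ordinal.{u}}
    (hγ : γ < α) : ¬ ({x | rk d t ρ h x = γ} \ K).Countable := by
  intro hc
  obtain ⟨ν, h1, h2⟩ := hcov γ hγ
  obtain ⟨γ', rfl⟩ := exists_add_of_le h1
  obtain ⟨y, rfl⟩ := (hY ν).exists_rank γ' (Order.lt_add_one_iff.2 (le_of_add_le_add_left h2))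
  refine (isNonstationary_of_isLindelof hd hK ν).not_countable_compl ?_
  have hinj : Function.Injective fun η : W => (⟨(ν, η), y⟩ : Blowup d t) := by
    intro η η' he
    exact (Prod.ext_iff.1 (congrArg Blowup.fst he)).2
  refine Set.Countable.mono (fun η hη => ?_) (hc.preimage hinj)
  refine Set.mem_preimage.2 ((Set.mem_sdiff _).2 ⟨Set.mem_ofPred.2 rfl, fun hm => hη ⟨y, hm⟩⟩)

end

end Blowup

/-! ### One-point Lindelöfications -/

theorem IsPSpace.isOpen_biInter {X ι : Type u} [TopologicalSpace X] (h : IsPSpace X) {s : Set ι}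
    (hs : s.Countable) {O : ι → Set X} (hO : ∀ i, IsOpen (O i)) : IsOpen (⋂ i ∈ s, O i) := by
  rcases s.eq_empty_or_nonempty with rfl | hne
  · simp
  · obtain ⟨f, rfl⟩ := hs.exists_eq_range hne
    rw [Set.biInter_range]
    exact h _ fun n => hO _

/-- The one-point Lindelöfication. -/
def Lindelofication (X : Type u) : Type u := Option X

namespace Lindelofication

variable {X : Type u}

/-- The inclusion of the original space. -/
def incl (x : X) : Lindelofication X := some x

/-- The added point. -/
def top : Lindelofication X := none

theorem incl_injective : Function.Injective (incl : X → Lindelofication X) :=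
  Option.some_injective X

theorem incl_ne_top (x : X) : incl x ≠ top := Option.some_ne_none x

theorem cases_point (z : Lindelofication X) : z = top ∨ ∃ x, z = incl x := by
  cases z with
  | none => exact Or.inl rfl
  | some x => exact Or.inr ⟨x, rfl⟩

/-- The extension of a rank function by a value at the added point. -/
def rk (ρ : X → Ordinal.{u}) (α : Ordinal.{u}) (z : Lindelofication X) : Ordinal.{u} :=
  Option.elim z α ρ

variable [TopologicalSpace X]

instance : TopologicalSpace (Lindelofication X) where
  IsOpen O := IsOpen (incl ⁻¹' O) ∧ (top ∈ O → IsLindelof (incl ⁻¹' O)ᶜ)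
  isOpen_univ := ⟨isOpen_univ, fun _ => by simp⟩
  isOpen_inter O O' hO hO' := ⟨hO.1.inter hO'.1, fun h => by
    rw [Set.preimage_inter, Set.compl_inter]
    exact (hO.2 h.1).union (hO'.2 h.2)⟩
  isOpen_sUnion s hs := by
    have hop : IsOpen (incl ⁻¹' (⋃₀ s) : Set X) := by
      rw [Set.preimage_sUnion]
      exact isOpen_biUnion fun O hO => (hs O hO).1
    refine ⟨hop, ?_⟩
    rintro ⟨O, hO, h⟩
    exact ((hs O hO).2 h).of_isClosed_subset hop.isClosed_compl
      (Set.compl_subset_compl.2 (Set.preimage_mono (Set.subset_sUnion_of_mem hO)))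

theorem isOpen_iff {O : Set (Lindelofication X)} :
    IsOpen O ↔ IsOpen (incl ⁻¹' O) ∧ (top ∈ O → IsLindelof (incl ⁻¹' O)ᶜ) := Iff.rfl

theorem continuous_incl : Continuous (incl : X → Lindelofication X) :=
  ⟨fun _ hO => (isOpen_iff.1 hO).1⟩

omit [TopologicalSpace X] in
theorem top_notMem_image (A : Set X) : (top : Lindelofication X) ∉ incl '' A := by
  rintro ⟨x, -, h⟩
  exact incl_ne_top x h

theorem isOpenMap_incl : IsOpenMap (incl : X → Lindelofication X) := by
  intro A hA
  refine isOpen_iff.2 ⟨?_, fun h => absurd h (top_notMem_image A)⟩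
  rwa [incl_injective.preimage_image]

theorem isClopen_image {A : Set X} (hA : IsClopen A) (hL : IsLindelof A) :
    IsClopen (incl '' A : Set (Lindelofication X)) := by
  refine ⟨⟨isOpen_iff.2 ?_⟩, isOpenMap_incl A hA.isOpen⟩
  rw [Set.preimage_compl, incl_injective.preimage_image, compl_compl]
  exact ⟨hA.compl.isOpen, fun _ => hL⟩

instance : LindelofSpace (Lindelofication X) := by
  refine ⟨isLindelof_of_isLindelof_diff (K := {top}) isLindelof_singleton
    (Set.subset_univ _) fun O hO htop => ?_⟩
  have : Set.univ \ O = incl '' (incl ⁻¹' O)ᶜ := by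
    ext z
    rcases cases_point z with rfl | ⟨x, rfl⟩
    · simp only [top_notMem_image, iff_false]
      exact fun h => h.2 (htop rfl)
    · rw [incl_injective.mem_set_image]
      simp
  rw [this]
  exact ((isOpen_iff.1 hO).2 (htop rfl)).image continuous_incl

/-- Neighbourhoods of the added point have Lindelöf complement, so `hgood` makes it accumulate every
rank below `α`. -/
theorem isRankedSpace {ρ : X → Ordinal.{u}} {α : Ordinal.{u}} (h : IsRankedSpace X ρ α)
    (hgood : ∀ K : Set X, IsLindelof K → ∀ γ < α, ∃ x ∉ K, ρ x = γ) :
    IsRankedSpace (Lindelofication X) (rk ρ α) (α + 1) where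
  t2 := by
    have key : ∀ (x : X) (z : Lindelofication X), incl x ≠ z →
        ∃ A : Set (Lindelofication X), IsClopen A ∧ incl x ∈ A ∧ z ∉ A := by
      intro x z hz
      rcases cases_point z with rfl | ⟨y, rfl⟩
      · obtain ⟨A, hA, hL, hx, -⟩ := h.basis x Set.univ isOpen_univ trivial
        exact ⟨_, isClopen_image hA hL, ⟨x, hx, rfl⟩, top_notMem_image A⟩
      · have := h.t2
        have hxy : x ≠ y := fun e => hz (by rw [e])
        obtain ⟨A, hA, hL, hx, hAy⟩ := h.basis x {y}ᶜ isOpen_compl_singleton hxy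
        refine ⟨_, isClopen_image hA hL, ⟨x, hx, rfl⟩, ?_⟩
        rw [incl_injective.mem_set_image]
        exact fun hy => hAy hy rfl
    refine t2Space_of_clopen fun z z' hzz' => ?_
    rcases cases_point z with rfl | ⟨x, rfl⟩
    · rcases cases_point z' with rfl | ⟨x, rfl⟩
      · exact absurd rfl hzz'
      · obtain ⟨A, hA, hx⟩ := key x top hzz'.symm
        exact ⟨A, hA, Or.inr hx⟩
    · obtain ⟨A, hA, hx⟩ := key x z' hzz'
      exact ⟨A, hA, Or.inl hx⟩
  pSpace U hU := by
    rw [isOpen_iff, Set.preimage_iInter]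
    refine ⟨h.pSpace _ fun n => (isOpen_iff.1 (hU n)).1, fun htop => ?_⟩
    rw [Set.compl_iInter]
    exact isLindelof_iUnion fun n => (isOpen_iff.1 (hU n)).2 (Set.mem_iInter.1 htop n)
  basis z O hO hz := by
    rcases cases_point z with rfl | ⟨x, rfl⟩
    · choose A hA hL hxA _ using fun x => h.basis x Set.univ isOpen_univ trivial
      obtain ⟨s, hs, hsub⟩ := ((isOpen_iff.1 hO).2 hz).elim_countable_subcover A
        (fun x => (hA x).isOpen) fun x _ => Set.mem_iUnion.2 ⟨x, hxA x⟩
      -- The union stays closed because `X` is a P-space and `s` is countable.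
      have hB : IsClopen (⋃ x ∈ s, A x) := by
        refine ⟨⟨?_⟩, isOpen_biUnion fun x _ => (hA x).isOpen⟩
        simp only [Set.compl_iUnion]
        exact h.pSpace.isOpen_biInter hs fun x => (hA x).compl.isOpen
      have hC := (isClopen_image hB (hs.isLindelof_biUnion fun x _ => hL x)).compl
      refine ⟨_, hC, hC.isClosed.isLindelof, top_notMem_image _, ?_⟩
      intro z' hz'
      rcases cases_point z' with rfl | ⟨x, rfl⟩
      · exact hz
      · by_contra hx
        exact hz' ⟨x, hsub hx, rfl⟩
    · obtain ⟨A, hA, hL, hx, hAO⟩ := h.basis x _ (isOpen_iff.1 hO).1 hz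
      exact ⟨incl '' A, isClopen_image hA hL, hL.image continuous_incl, ⟨x, hx, rfl⟩,
        Set.image_subset_iff.2 hAO⟩
  cone z := by
    rcases cases_point z with rfl | ⟨x, rfl⟩
    · refine ⟨Set.univ, Filter.univ_mem, fun z _ hz => ?_⟩
      rcases cases_point z with rfl | ⟨y, rfl⟩
      · exact absurd rfl hz
      · exact h.rank_lt y
    · obtain ⟨A, hA, hAx⟩ := h.cone x
      refine ⟨incl '' A, isOpenMap_incl.image_mem_nhds hA, ?_⟩
      rintro _ ⟨y, hy, rfl⟩ hne
      exact hAx y hy fun e => hne (by rw [e])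
  meets z N hN γ hγ := by
    rcases cases_point z with rfl | ⟨x, rfl⟩
    · obtain ⟨O, hON, hO, htop⟩ := mem_nhds_iff.1 hN
      obtain ⟨x, hx, hρ⟩ := hgood _ ((isOpen_iff.1 hO).2 htop) γ hγ
      exact ⟨incl x, hON (Set.notMem_compl_iff.1 hx), hρ⟩
    · obtain ⟨y, hy, hρ⟩ := h.meets x _ (continuous_incl.continuousAt hN) γ hγ
      exact ⟨incl y, hy, hρ⟩
  rank_lt z := by
    rcases cases_point z with rfl | ⟨x, rfl⟩
    · exact Order.lt_add_one_iff.2 le_rfl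
    · exact (h.rank_lt x).trans (Order.lt_add_one_iff.2 le_rfl)
  exists_rank γ hγ := by
    rcases (Order.lt_add_one_iff.1 hγ).lt_or_eq with hlt | rfl
    · obtain ⟨x, rfl⟩ := h.exists_rank γ hlt
      exact ⟨incl x, rfl⟩
    · exact ⟨top, rfl⟩
  card_le γ := by
    have hsub : {z | rk ρ α z = γ} ⊆ insert top (incl '' {x | ρ x = γ}) := by
      intro z hz
      rcases cases_point z with rfl | ⟨x, rfl⟩
      · exact Set.mem_insert _ _
      · exact Set.mem_insert_of_mem _ ⟨x, hz, rfl⟩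
    refine (Cardinal.mk_le_mk_of_subset hsub).trans (Cardinal.mk_insert_le.trans ?_)
    refine (add_le_add (Cardinal.mk_image_le.trans (h.card_le γ)) le_rfl).trans ?_
    rw [Cardinal.add_one_eq (Cardinal.aleph0_le_aleph 1)]

end Lindelofication

/-! ### Cofinal sequences and the induction on the height -/

/-- Ordinals below `ω₃` have strictly increasing cofinal sequences whose proper initial segments
have size at most `ℵ₁`. -/
theorem exists_cofinal_sequence {α : Ordinal.{u}} (hα : α < ω_ 3) :
    ∃ (V : Type u) (_ : LinearOrder V) (_ : WellFoundedLT V) (a : V → Ordinal.{u}),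
      StrictMono a ∧ (∀ ν, a ν < α) ∧ (∀ γ < α, ∃ ν, γ ≤ a ν) ∧ ∀ ν : V, #(Set.Iio ν) ≤ ℵ_ 1 := by
  obtain ⟨s, hs, hs'⟩ := Ordinal.exists_ord_cof_eq α.ToType
  rw [Ordinal.cof_toType] at hs'
  have hcard : #s = α.cof := by
    have := congrArg Ordinal.card hs'
    rwa [Ordinal.card_type, Cardinal.card_ord] at this
  have hlt : α.cof < ℵ_ 3 := by
    refine (Ordinal.cof_le_card α).trans_lt ?_
    rwa [← Cardinal.lt_ord, Cardinal.ord_aleph]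
  -- The bound `ω₃` enters here: initial segments of a cofinal set of minimal order type have size
  -- below `α.cof ≤ ℵ₂`.
  have hle : α.cof ≤ Order.succ (ℵ_ 1) := by
    rw [Cardinal.succ_aleph, ← Order.lt_succ_iff, Cardinal.succ_aleph]
    norm_num
    exact hlt
  refine ⟨s, inferInstance, inferInstance,
    fun ν => ((Ordinal.ToType.mk.symm (ν : α.ToType) : Set.Iio α) : Ordinal.{u}), ?_, ?_, ?_, ?_⟩
  · intro μ ν h
    exact Ordinal.ToType.mk.symm.strictMono h
  · exact fun ν => (Ordinal.ToType.mk.symm (ν : α.ToType)).2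
  · intro γ hγ
    obtain ⟨x, hx, hle⟩ := hs (Ordinal.ToType.mk ⟨γ, hγ⟩)
    refine ⟨⟨x, hx⟩, ?_⟩
    have := Ordinal.ToType.mk.symm.monotone hle
    rwa [OrderIso.symm_apply_apply] at this
  · intro ν
    refine Order.lt_succ_iff.1 (lt_of_lt_of_le ?_ hle)
    rw [← hcard]
    exact Cardinal.mk_Iio_lt ν (by rw [hcard, hs'])

instance isOmegaOne_toType : IsOmegaOne (ω_ 1 : Ordinal.{u}).ToType where
  wf := inferInstance
  countable_Iic w := by
    have : #(Set.Iio w) < ℵ_ 1 := by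
      have := Cardinal.mk_Iio_lt w (by simp)
      simpa using this
    rw [← Cardinal.succ_aleph0, Order.lt_succ_iff, Cardinal.le_aleph0_iff_set_countable] at this
    rw [← Set.Iio_insert]
    exact this.insert w
  card_eq := by simp

/-- If there are suitable Lindelöf spaces of all smaller successor heights, there is a ranked space
in which no level is covered, up to countably many points, by a Lindelöf set. -/
theorem exists_good_isRankedSpace {α : Ordinal.{u}} (hα : α < ω_ 3)
    (ih : ∀ β < α, ∃ (Y : Type u) (_ : TopologicalSpace Y) (ρ : Y → Ordinal.{u}),
      LindelofSpace Y ∧ IsRankedSpace Y ρ (β + 1)) :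
    ∃ (X : Type u) (_ : TopologicalSpace X) (ρ : X → Ordinal.{u}), IsRankedSpace X ρ α ∧
      ∀ K : Set X, IsLindelof K → ∀ γ < α, ¬ ({x | ρ x = γ} \ K).Countable := by
  obtain ⟨V, _, _, a, ha, haα, hcof, hV⟩ := exists_cofinal_sequence hα
  let W := (ω_ 1 : Ordinal.{u}).ToType
  obtain ⟨d, hd⟩ := exists_skeleton (W := W) hV
  -- Copies at level `ν` fill the ranks from `h ν` to `a ν`, where `h ν` is the first rank not used
  -- by earlier levels.
  let h : V → Ordinal.{u} := fun ν => ⨆ μ : Set.Iio ν, (a μ + 1)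
  have hlt : ∀ μ ν, μ < ν → a μ < h ν := fun μ ν hμ =>
    Order.add_one_le_iff.1 (Ordinal.le_iSup (fun μ : Set.Iio ν => a μ + 1) ⟨μ, hμ⟩)
  have hle : ∀ ν, h ν ≤ a ν := fun ν =>
    Ordinal.iSup_le fun μ => Order.add_one_le_iff.2 (ha μ.2)
  have hsub : ∀ ν, h ν + (a ν - h ν) = a ν := fun ν => Ordinal.add_sub_cancel_of_le (hle ν)
  choose Y hYtop ρ hYL hY using fun ν => ih (a ν - h ν)
    ((Ordinal.sub_le_self _ _).trans_lt (haα ν))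
  have ht : ∀ ν, ∃ t : W → Y ν, ∀ y, ρ ν y = 0 → ∃ ζ, t ζ = y := by
    intro ν
    obtain ⟨y₀, hy₀⟩ := (hY ν).exists_rank 0 (Order.lt_add_one_iff.2 zero_le)
    have hcard : #{y | ρ ν y = 0} ≤ #W := by
      rw [IsOmegaOne.card_eq (W := W)]
      exact (hY ν).card_le 0
    obtain ⟨e⟩ : Nonempty ({y | ρ ν y = 0} ↪ W) := hcard
    have : Nonempty {y | ρ ν y = 0} := ⟨⟨y₀, hy₀⟩⟩
    exact ⟨fun w => (Function.invFun e w : {y | ρ ν y = 0}), fun y hy =>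
      ⟨e ⟨y, hy⟩, congrArg Subtype.val (Function.leftInverse_invFun e.injective ⟨y, hy⟩)⟩⟩
  choose t ht using ht
  have hcov : ∀ γ < α, ∃ ν, h ν ≤ γ ∧ γ ≤ h ν + (a ν - h ν) := by
    intro γ hγ
    have hne : {ν | γ ≤ a ν}.Nonempty := hcof γ hγ
    have wf : WellFounded ((· < ·) : V → V → Prop) := wellFounded_lt
    refine ⟨wf.min _ hne, Ordinal.iSup_le fun μ => ?_, ?_⟩
    · rw [Order.add_one_le_iff]
      by_contra! hγμ
      exact wf.not_lt_min {ν | γ ≤ a ν} hγμ μ.2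
    · rw [hsub]
      exact wf.min_mem _ hne
  refine ⟨Blowup d t, inferInstance, Blowup.rk d t ρ h, ?_, fun K hK γ hγ => ?_⟩
  · exact Blowup.isRankedSpace hd hY ht (fun μ ν hμ => by rw [hsub]; exact hlt μ ν hμ)
      (fun ν => by rw [hsub]; exact haα ν) hcov
  · exact Blowup.not_countable_level_diff hd hY hcov hK hγ

theorem exists_lindelof_isRankedSpace (α : Ordinal.{u}) (hα : α < ω_ 3) :
    ∃ (Y : Type u) (_ : TopologicalSpace Y) (ρ : Y → Ordinal.{u}),
      LindelofSpace Y ∧ IsRankedSpace Y ρ (α + 1) := by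
  induction α using WellFoundedLT.induction with
  | ind α ih =>
    obtain ⟨X, _, ρ, hX, hgood⟩ := exists_good_isRankedSpace hα fun β hβ => ih β hβ (hβ.trans hα)
    refine ⟨Lindelofication X, inferInstance, Lindelofication.rk ρ α, inferInstance,
      Lindelofication.isRankedSpace hX fun K hK γ hγ => ?_⟩
    by_contra! hcon
    refine hgood K hK γ hγ ?_
    have : {x | ρ x = γ} \ K = ∅ :=
      Set.eq_empty_iff_forall_notMem.2 fun x hx => hcon x hx.2 hx.1
    rw [this]
    exact Set.countable_empty

end LLSP

theorem corollary3p4 (α : Ordinal.{u}) (hα₀ : α ≠ 0) (hα : α < ω_ 3) :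
    ∃ (X : Type u) (_ : TopologicalSpace X),
      LLSP.IsLLSPSpaceOf (ℵ_ 1) α X ∧ LLSP.IsGood X := by
  obtain ⟨X, hX, ρ, h, hgood⟩ := LLSP.exists_good_isRankedSpace hα fun β hβ =>
    LLSP.exists_lindelof_isRankedSpace β (hβ.trans hα)
  exact ⟨X, hX, h.isLLSPSpaceOf hα₀ hgood⟩
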